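/- Let $N \ge 1$ be an integer, let $1 \le p < \infty$, and let $u : \mathbb{R}^N \to \mathbb{R}$ be a Lebesgue measurable function. Write $|\cdot|$ for the Euclidean norm on $\mathbb{R}^N$ and $\mathcal{L}^{2N}$ for Lebesgue measure on $\mathbb{R}^N \times \mathbb{R}^N$. If $$\lim_{\lambda \to \infty} \lambda^p \, \mathcal{L}^{2N}\biggl(\biggl\{ (x,y) \in \mathbb{R}^N \times \mathbb{R}^N : \frac{|u(x)-u(y)|}{|x-y|^{\frac{N}{p}+1}} \ge \lambda \biggr\}\biggr) = 0,$$ then $u$ is constant almost everywhere, that is, there is $c \in \mathbb{R}$ with $u(x) = c$ for Lebesgue-almost every $x \in \mathbb{R}^N$. -/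

import Mathlib

open MeasureTheory Filter Topology

open Module Metric Set
open scoped ENNReal

/-! Replace `u` by the bounded function v = arctan u, which only shrinks differences, and put D(x,h)
= |v(x+h) - v(x)|^p / |h|^(N+p). Splitting a step 2h into two steps h shows that the integral of D
over a dyadic annulus in h (x in a ball) does not decrease as the annulus shrinks, up to enlarging
the ball. Hence n times the integral over one annulus is at most the integral over r/2^n ≤ |h| < r.
There D ≤ 2^(K+nQ), so only K + nQ dyadic levels matter, and the weak-type hypothesis charges each
at most 2δ: the total is O(1) + 2nQδ. Divide by n, let n → ∞, then δ → 0: every annulus integral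
vanishes, so v(x+h) = v(x) almost everywhere. -/

theorem lintegral_le_of_mul_meas_ge_le {α : Type*} [MeasurableSpace α] {ν : Measure α}
    {Λ δ : ℝ≥0∞} (J : ℕ) {f : α → ℝ≥0∞} (hf : Measurable f) (hfJ : ∀ x, f x ≤ 2 ^ J * Λ)
    (hδ : ∀ j : ℕ, 2 ^ j * Λ * ν {x | 2 ^ j * Λ ≤ f x} ≤ δ) :
    ∫⁻ x, f x ∂ν ≤ Λ * ν univ + 2 * J * δ := by
  induction J generalizing f with
  | zero =>
    calc ∫⁻ x, f x ∂ν ≤ ∫⁻ _, Λ ∂ν := lintegral_mono fun x => by simpa using hfJ x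
      _ ≤ _ := by simp
  | succ J ih =>
    have hset : MeasurableSet {x | 2 ^ J * Λ ≤ f x} := measurableSet_le measurable_const hf
    have hmin : ∫⁻ x, min (f x) (2 ^ J * Λ) ∂ν ≤ Λ * ν univ + 2 * J * δ := by
      refine ih (hf.min measurable_const) (fun x => min_le_right _ _) fun j => le_trans ?_ (hδ j)
      gcongr
      exact min_le_left _ _
    -- Peel off the top dyadic level: there f is at most twice the threshold, so Chebyshev-type
    -- control costs 2δ; the truncation falls under the induction hypothesis.
    calc ∫⁻ x, f x ∂ν
        ≤ ∫⁻ x, (min (f x) (2 ^ J * Λ) +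
            {x | 2 ^ J * Λ ≤ f x}.indicator (fun _ => 2 * (2 ^ J * Λ)) x) ∂ν := by
          refine lintegral_mono fun x => ?_
          by_cases hx : 2 ^ J * Λ ≤ f x
          · rw [indicator_of_mem (by exact hx)]
            refine (hfJ x).trans (le_trans (le_of_eq ?_) le_add_self)
            ring
          · rw [indicator_of_notMem (by exact hx), min_eq_left (not_le.1 hx).le, add_zero]
      _ = ∫⁻ x, min (f x) (2 ^ J * Λ) ∂ν + 2 * (2 ^ J * Λ) * ν {x | 2 ^ J * Λ ≤ f x} := by
          rw [lintegral_add_left (hf.min measurable_const), lintegral_indicator_const hset]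
      _ ≤ (Λ * ν univ + 2 * J * δ) + 2 * δ := by
          refine add_le_add hmin ?_
          rw [mul_assoc]
          exact mul_le_mul_right (hδ J) _
      _ = _ := by push_cast; ring

theorem ENNReal.eq_zero_of_forall_nat_mul_le {a c : ℝ≥0∞}
    (hc : c ≠ ∞)
    (h : ∀ δ : ℝ≥0∞, δ ≠ 0 → δ ≠ ∞ → ∃ b : ℝ≥0∞, b ≠ ∞ ∧ ∀ n : ℕ, n * a ≤ b + n * (c * δ)) :
    a = 0 := by
  have key : ∀ δ : ℝ≥0∞, δ ≠ 0 → δ ≠ ∞ → a ≤ c * δ := by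
    intro δ h0 h1
    obtain ⟨b, hb, hn⟩ := h δ h0 h1
    have ht : Tendsto (fun n : ℕ => b / n + c * δ) atTop (𝓝 (0 + c * δ)) :=
      (ENNReal.Tendsto.const_div ENNReal.tendsto_nat_nhds_top (Or.inr hb)).add
        tendsto_const_nhds |>.trans (by simp)
    rw [zero_add] at ht
    refine ge_of_tendsto ht ?_
    filter_upwards [eventually_gt_atTop 0] with n hn0
    have hne : (n : ℝ≥0∞) ≠ 0 := by exact_mod_cast hn0.ne'
    have hnt : (n : ℝ≥0∞) ≠ ∞ := ENNReal.natCast_ne_top n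
    refine (ENNReal.mul_le_mul_iff_right hne hnt).1 ((hn n).trans (le_of_eq ?_))
    rw [mul_add, ENNReal.mul_div_cancel hne hnt]
  have ht : Tendsto (fun n : ℕ => c * (n : ℝ≥0∞)⁻¹) atTop (𝓝 (c * 0)) :=
    ENNReal.Tendsto.const_mul ENNReal.tendsto_inv_nat_nhds_zero (Or.inr hc)
  rw [mul_zero] at ht
  refine le_antisymm (ge_of_tendsto ht ?_) bot_le
  filter_upwards [eventually_gt_atTop 0] with n hn0
  exact key _ (by simp) (by simp [hn0.ne'])

/-! ### Monotonicity of the annulus integrals under halving -/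

section DifferenceQuotient

variable {E : Type*} [NormedAddCommGroup E]

/-- The `p`-th power of the difference quotient of `v` between `z.1` and `z.1 + z.2`, with
denominator `‖z.2‖ ^ s`. -/
noncomputable def diffQuotient (s p : ℝ) (v : E → ℝ) (z : E × E) : ℝ≥0∞ :=
  ENNReal.ofReal (|v (z.1 + z.2) - v z.1| ^ p / ‖z.2‖ ^ s)

theorem measurable_diffQuotient [MeasurableSpace E] [BorelSpace E] [SecondCountableTopology E]
    (s p : ℝ) {v : E → ℝ} (hv : Measurable v) : Measurable (diffQuotient s p v) := by
  unfold diffQuotient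
  fun_prop

theorem abs_add_rpow_le {p : ℝ} (hp : 1 ≤ p) (a b : ℝ) :
    |a + b| ^ p ≤ 2 ^ (p - 1) * (|a| ^ p + |b| ^ p) := by
  have h : (|a| + |b|) ^ p ≤ 2 ^ (p - 1) * (|a| ^ p + |b| ^ p) := by
    exact_mod_cast NNReal.rpow_add_le_mul_rpow_add_rpow ⟨|a|, abs_nonneg a⟩ ⟨|b|, abs_nonneg b⟩ hp
  exact (Real.rpow_le_rpow (abs_nonneg _) (abs_add_le a b) (by linarith)).trans h

/-- Doubling h gives 2^(d+p) in the denominator, and convexity of the p-th power loses only 2^(p-1).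
-/
theorem two_pow_mul_diffQuotient_two_smul_le [NormedSpace ℝ E] {p : ℝ} (hp : 1 ≤ p) (d : ℕ)
    (v : E → ℝ) (x h : E) :
    2 ^ (d + 1) * diffQuotient (d + p) p v (x, (2 : ℝ) • h) ≤
      diffQuotient (d + p) p v (x, h) + diffQuotient (d + p) p v (x + h, h) := by
  have h2 : (2 : ℝ≥0∞) ^ (d + 1) = ENNReal.ofReal (2 ^ (d + 1)) := by
    rw [ENNReal.ofReal_pow (by norm_num)]; simp
  unfold diffQuotient
  rw [h2, ← ENNReal.ofReal_mul (by positivity), ← ENNReal.ofReal_add (by positivity)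
    (by positivity)]
  refine ENNReal.ofReal_le_ofReal ?_
  have hx : x + (2 : ℝ) • h = x + h + h := by rw [two_smul, add_assoc]
  simp only [hx, norm_smul, Real.norm_ofNat]
  have hab := abs_add_rpow_le hp (v (x + h + h) - v (x + h)) (v (x + h) - v x)
  rw [sub_add_sub_cancel] at hab
  have hpow : (2 : ℝ) ^ ((d : ℝ) + p) = 2 ^ (d + 1) * 2 ^ (p - 1) := by
    rw [← Real.rpow_natCast, ← Real.rpow_add two_pos]
    congr 1
    push_cast
    ring
  rw [Real.mul_rpow two_pos.le (norm_nonneg h), hpow, ← add_div]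
  have hh : 0 ≤ ‖h‖ ^ ((d : ℝ) + p) := by positivity
  have h3 : (0 : ℝ) < 2 ^ (p - 1) := by positivity
  calc (2 : ℝ) ^ (d + 1) * (|v (x + h + h) - v x| ^ p /
        (2 ^ (d + 1) * 2 ^ (p - 1) * ‖h‖ ^ ((d : ℝ) + p)))
      = |v (x + h + h) - v x| ^ p / 2 ^ (p - 1) / ‖h‖ ^ ((d : ℝ) + p) := by
        field_simp
    _ ≤ _ := by
        refine div_le_div_of_nonneg_right ?_ hh
        rw [div_le_iff₀ h3]
        linarith

theorem preimage_two_smul_ball_diff_ball [NormedSpace ℝ E] (a b : ℝ) :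
    (fun h : E => (2 : ℝ) • h) ⁻¹' (ball 0 a \ ball 0 b) = ball 0 (a / 2) \ ball 0 (b / 2) := by
  ext h
  simp only [mem_preimage, Set.mem_sdiff, mem_ball_zero_iff, norm_smul, Real.norm_ofNat]
  constructor <;> rintro ⟨h1, h2⟩ <;> constructor <;> linarith

variable [NormedSpace ℝ E] [FiniteDimensional ℝ E] [MeasurableSpace E] [BorelSpace E]
  (μ : Measure E) [μ.IsAddHaarMeasure]

theorem lintegral_ball_diffQuotient_two_smul_le {p : ℝ} (hp : 1 ≤ p) (d : ℕ)
    {v : E → ℝ} (hv : Measurable v) (R : ℝ) (h : E) :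
    2 ^ (d + 1) * ∫⁻ x in ball 0 R, diffQuotient (d + p) p v (x, (2 : ℝ) • h) ∂μ ≤
      2 * ∫⁻ x in ball 0 (R + ‖h‖), diffQuotient (d + p) p v (x, h) ∂μ := by
  have hm := measurable_diffQuotient (d + p) p hv
  have hm' : ∀ k : E, Measurable fun x => diffQuotient (d + p) p v (x, k) := fun k =>
    hm.comp (by fun_prop)
  rw [← lintegral_const_mul _ (hm' _)]
  calc _ ≤ ∫⁻ x in ball 0 R,
        (diffQuotient (d + p) p v (x, h) + diffQuotient (d + p) p v (x + h, h)) ∂μ :=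
        lintegral_mono fun x => two_pow_mul_diffQuotient_two_smul_le hp d v x h
    _ = ∫⁻ x in ball 0 R, diffQuotient (d + p) p v (x, h) ∂μ +
        ∫⁻ x in ball 0 R, diffQuotient (d + p) p v (x + h, h) ∂μ := lintegral_add_left (hm' h) _
    _ ≤ _ := by
        rw [two_mul]
        refine add_le_add (lintegral_mono_set (ball_subset_ball (by simp))) ?_
        rw [← lintegral_indicator measurableSet_ball, ← lintegral_indicator measurableSet_ball,
          ← lintegral_add_right_eq_self
            ((ball 0 (R + ‖h‖)).indicator fun x => diffQuotient (d + p) p v (x, h)) h]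
        refine lintegral_mono fun x => ?_
        refine indicator_le' (g := fun x => (ball 0 (R + ‖h‖)).indicator
          (fun x => diffQuotient (d + p) p v (x, h)) (x + h))
          (fun y hy => ?_) (fun _ _ => zero_le) x
        rw [indicator_of_mem]
        rw [mem_ball_zero_iff] at hy ⊢
        exact (norm_add_le _ _).trans_lt (by linarith)

theorem setLIntegral_eq_two_smul (F : E → ℝ≥0∞) (s : Set E) :
    ∫⁻ h in s, F h ∂μ =
      2 ^ finrank ℝ E * ∫⁻ h in (fun h => (2 : ℝ) • h) ⁻¹' s, F ((2 : ℝ) • h) ∂μ := by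
  have hemb : MeasurableEmbedding (fun h : E => (2 : ℝ) • h) :=
    (Homeomorph.smulOfNeZero (2 : ℝ) two_ne_zero).measurableEmbedding
  have h1 : ∫⁻ h in s, F h ∂(Measure.map (fun h : E => (2 : ℝ) • h) μ) =
      ∫⁻ h in (fun h => (2 : ℝ) • h) ⁻¹' s, F ((2 : ℝ) • h) ∂μ := by
    rw [hemb.restrict_map, hemb.lintegral_map]
  rw [← h1, Measure.map_addHaar_smul μ two_ne_zero, Measure.restrict_smul, lintegral_smul_measure,
    smul_eq_mul, ← mul_assoc, abs_of_pos (by positivity), ENNReal.ofReal_inv_of_pos (by positivity),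
    ENNReal.ofReal_pow (by norm_num), ENNReal.ofReal_ofNat,
    ENNReal.mul_inv_cancel (by simp) (by simp), one_mul]

/-- The Jacobian 2^N of h ↦ 2h and the factor 2 from the two half-steps exactly balance the gain
2^(N+1). -/
theorem lintegral_annulus_diffQuotient_le_half {p : ℝ} (hp : 1 ≤ p)
    {v : E → ℝ} (hv : Measurable v) (R r : ℝ) :
    ∫⁻ h in ball 0 r \ ball 0 (r / 2), ∫⁻ x in ball 0 R,
        diffQuotient (finrank ℝ E + p) p v (x, h) ∂μ ∂μ ≤
      ∫⁻ h in ball 0 (r / 2) \ ball 0 (r / 2 / 2), ∫⁻ x in ball 0 (R + r / 2),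
        diffQuotient (finrank ℝ E + p) p v (x, h) ∂μ ∂μ := by
  have hA : ∀ a b : ℝ, MeasurableSet (ball (0 : E) a \ ball 0 b) := fun a b =>
    measurableSet_ball.diff measurableSet_ball
  rw [setLIntegral_eq_two_smul μ, preimage_two_smul_ball_diff_ball,
    ← ENNReal.mul_le_mul_iff_right two_ne_zero ENNReal.ofNat_ne_top, ← mul_assoc, ← pow_succ',
    ← lintegral_const_mul' _ _ (by simp), ← lintegral_const_mul' _ _ (by simp)]
  refine setLIntegral_mono' (hA _ _) fun h hh => ?_
  refine (lintegral_ball_diffQuotient_two_smul_le μ hp _ hv R h).trans ?_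
  gcongr
  exact (mem_ball_zero_iff.1 hh.1).le

theorem lintegral_annulus_diffQuotient_le {p : ℝ} (hp : 1 ≤ p)
    {v : E → ℝ} (hv : Measurable v) (R : ℝ) {r : ℝ} (hr : 0 ≤ r) (m : ℕ) :
    ∫⁻ h in ball 0 r \ ball 0 (r / 2), ∫⁻ x in ball 0 R,
        diffQuotient (finrank ℝ E + p) p v (x, h) ∂μ ∂μ ≤
      ∫⁻ h in ball 0 (r / 2 ^ m) \ ball 0 (r / 2 ^ (m + 1)), ∫⁻ x in ball 0 (R + r),
        diffQuotient (finrank ℝ E + p) p v (x, h) ∂μ ∂μ := by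
  -- The enlargements r/2 + r/4 + ... are tracked exactly for the induction; their sum stays below
  -- r.
  have key : ∫⁻ h in ball 0 r \ ball 0 (r / 2), ∫⁻ x in ball 0 R,
        diffQuotient (finrank ℝ E + p) p v (x, h) ∂μ ∂μ ≤
      ∫⁻ h in ball 0 (r / 2 ^ m) \ ball 0 (r / 2 ^ m / 2),
        ∫⁻ x in ball 0 (R + (r - r / 2 ^ m)),
        diffQuotient (finrank ℝ E + p) p v (x, h) ∂μ ∂μ := by
    induction m with
    | zero => simp
    | succ m ih =>
      refine (ih.trans (lintegral_annulus_diffQuotient_le_half μ hp hv _ _)).trans (le_of_eq ?_)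
      have h1 : r / 2 ^ (m + 1) = r / 2 ^ m / 2 := by rw [pow_succ, div_div]
      have h2 : R + (r - r / 2 ^ m) + r / 2 ^ m / 2 = R + (r - r / 2 ^ m / 2) := by ring
      rw [h1, h2]
  rw [pow_succ, ← div_div]
  refine key.trans (lintegral_mono fun h => lintegral_mono_set (ball_subset_ball ?_))
  have : 0 ≤ r / 2 ^ m := by positivity
  linarith

theorem nat_mul_lintegral_annulus_diffQuotient_le {p : ℝ} (hp : 1 ≤ p)
    {v : E → ℝ} (hv : Measurable v) (R : ℝ) {r : ℝ} (hr : 0 ≤ r) (n : ℕ) :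
    n * ∫⁻ h in ball 0 r \ ball 0 (r / 2), ∫⁻ x in ball 0 R,
        diffQuotient (finrank ℝ E + p) p v (x, h) ∂μ ∂μ ≤
      ∫⁻ h in ball 0 r \ ball 0 (r / 2 ^ n), ∫⁻ x in ball 0 (R + r),
        diffQuotient (finrank ℝ E + p) p v (x, h) ∂μ ∂μ := by
  induction n with
  | zero => simp
  | succ n ih =>
    have hle : r / 2 ^ (n + 1) ≤ r / 2 ^ n := by
      gcongr <;> norm_num
    have hle' : r / 2 ^ n ≤ r := div_le_self hr (one_le_pow₀ one_le_two)
    rw [← sdiff_union_sdiff_cancel (ball_subset_ball hle') (ball_subset_ball hle),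
      lintegral_union (measurableSet_ball.diff measurableSet_ball)]
    · push_cast
      rw [add_mul, one_mul]
      exact add_le_add ih (lintegral_annulus_diffQuotient_le μ hp hv R hr n)
    · exact disjoint_left.2 fun x hx hx' => hx.2 hx'.1

end DifferenceQuotient

/-! ### Vanishing of the annulus integrals and constancy -/

section Constancy

variable {E : Type*} [NormedAddCommGroup E]

theorem diffQuotient_le_two_pow {s p : ℝ} (hs : 0 ≤ s) (hp : 0 ≤ p) {v : E → ℝ} {C : ℝ}
    (hvC : ∀ x y, |v x - v y| ≤ C) {r : ℝ} (hr : 0 < r) :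
    ∃ K Q : ℕ, ∀ (n : ℕ) (x h : E), r / 2 ^ n ≤ ‖h‖ →
      diffQuotient s p v (x, h) ≤ 2 ^ (K + n * Q) := by
  obtain ⟨K, hK⟩ := pow_unbounded_of_one_lt (C ^ p / r ^ s) (one_lt_two (α := ℝ))
  obtain ⟨Q, hQ⟩ := exists_nat_ge s
  refine ⟨K, Q, fun n x h hh => ?_⟩
  have h2 : (2 : ℝ≥0∞) ^ (K + n * Q) = ENNReal.ofReal (2 ^ (K + n * Q)) := by
    rw [ENNReal.ofReal_pow (by norm_num)]; simp
  rw [h2]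
  refine ENNReal.ofReal_le_ofReal ?_
  have hC : 0 ≤ C := (abs_nonneg _).trans (hvC 0 0)
  calc |v (x + h) - v x| ^ p / ‖h‖ ^ s ≤ C ^ p / (r / 2 ^ n) ^ s := by
        gcongr
        exact hvC _ _
    _ = C ^ p / r ^ s * (2 ^ n) ^ s := by
        rw [Real.div_rpow hr.le (by positivity)]
        field_simp
    _ ≤ 2 ^ K * (2 ^ n) ^ (Q : ℝ) := by
        gcongr
        exact one_le_pow₀ one_le_two
    _ = 2 ^ (K + n * Q) := by rw [Real.rpow_natCast, pow_add, pow_mul]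

variable [NormedSpace ℝ E] [FiniteDimensional ℝ E] [MeasurableSpace E] [BorelSpace E]
  (μ : Measure E) [μ.IsAddHaarMeasure]

theorem lintegral_annulus_diffQuotient_eq_zero {p : ℝ} (hp : 1 ≤ p)
    {v : E → ℝ} (hv : Measurable v) {C : ℝ} (hvC : ∀ x y, |v x - v y| ≤ C)
    (hweak : ∀ δ : ℝ≥0∞, δ ≠ 0 → ∃ Λ : ℝ≥0∞, Λ ≠ ∞ ∧ ∀ t, Λ ≤ t → t ≠ ∞ →
      t * (μ.prod μ) {z | t ≤ diffQuotient (finrank ℝ E + p) p v z} ≤ δ)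
    (R : ℝ) {r : ℝ} (hr : 0 < r) :
    ∫⁻ h in ball 0 r \ ball 0 (r / 2), ∫⁻ x in ball 0 R,
        diffQuotient (finrank ℝ E + p) p v (x, h) ∂μ ∂μ = 0 := by
  have hm := measurable_diffQuotient (finrank ℝ E + p) p hv
  obtain ⟨K, Q, hKQ⟩ := diffQuotient_le_two_pow (s := finrank ℝ E + p) (by positivity)
    (by linarith : 0 ≤ p) hvC hr
  refine ENNReal.eq_zero_of_forall_nat_mul_le (c := 2 * Q) (by finiteness) fun δ hδ0 hδt => ?_
  obtain ⟨Λ, hΛ, hΛδ⟩ := hweak δ hδ0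
  set S : Set (E × E) := ball 0 (R + r) ×ˢ ball 0 r
  have hS : (μ.prod μ) S ≠ ∞ := by
    rw [Measure.prod_prod]
    exact ENNReal.mul_ne_top measure_ball_lt_top.ne measure_ball_lt_top.ne
  -- Levels start at `max Λ 1`: at least Λ for the weak bound, at least 1 so that 2^(K+nQ) is
  -- covered by K + nQ doublings.
  have hmax : max Λ 1 ≠ ∞ := by simp [hΛ]
  refine ⟨max Λ 1 * (μ.prod μ) S + 2 * K * δ, by finiteness, fun n => ?_⟩
  refine (nat_mul_lintegral_annulus_diffQuotient_le μ hp hv R hr.le n).trans ?_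
  have hA : MeasurableSet (ball (0 : E) r \ ball 0 (r / 2 ^ n)) :=
    measurableSet_ball.diff measurableSet_ball
  set T : Set (E × E) := ball 0 (R + r) ×ˢ (ball 0 r \ ball 0 (r / 2 ^ n))
  have hT : MeasurableSet T := measurableSet_ball.prod hA
  have hTS : T ⊆ S := prod_mono_right sdiff_subset
  rw [← lintegral_prod_symm' _ hm, Measure.prod_restrict]
  change ∫⁻ z in T, _ ∂_ ≤ _
  rw [← inter_eq_left.2 hTS, ← setLIntegral_indicator hT]
  refine (lintegral_le_of_mul_meas_ge_le (Λ := max Λ 1) (δ := δ) (K + n * Q) (hm.indicator hT)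
    ?_ ?_).trans (le_of_eq ?_)
  · refine indicator_le' (g := fun _ => 2 ^ (K + n * Q) * max Λ 1) (fun z hz => ?_)
      (fun _ _ => zero_le)
    refine (hKQ n z.1 z.2 ?_).trans (le_mul_of_one_le_right' (le_max_right _ _))
    simpa using hz.2.2
  · intro j
    refine le_trans ?_ (hΛδ (2 ^ j * max Λ 1) ?_ (by finiteness))
    · refine mul_le_mul_right ?_ _
      refine (Measure.restrict_apply_le _ _).trans (measure_mono fun z hz => ?_)
      exact le_trans (b := T.indicator (diffQuotient (finrank ℝ E + p) p v) z) hz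
        (indicator_le_self _ _ z)
    · exact (le_max_left _ _).trans (le_mul_of_one_le_left' (one_le_pow₀ one_le_two))
  · rw [Measure.restrict_apply_univ]
    push_cast
    ring

theorem exists_ae_eq_const_of_weak_diffQuotient [Nontrivial E] {p : ℝ} (hp : 1 ≤ p)
    {v : E → ℝ} (hv : Measurable v) {C : ℝ} (hvC : ∀ x y, |v x - v y| ≤ C)
    (hweak : ∀ δ : ℝ≥0∞, δ ≠ 0 → ∃ Λ : ℝ≥0∞, Λ ≠ ∞ ∧ ∀ t, Λ ≤ t → t ≠ ∞ →
      t * (μ.prod μ) {z | t ≤ diffQuotient (finrank ℝ E + p) p v z} ≤ δ) :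
    ∃ c, ∀ᵐ x ∂μ, v x = c := by
  have hm := measurable_diffQuotient (finrank ℝ E + p) p hv
  have hloc : ∀ (k : ℤ) (m : ℕ), ∀ᵐ z ∂(μ.prod μ),
      z ∈ ball (0 : E) (m : ℝ) ×ˢ (ball (0 : E) (2 ^ k) \ ball 0 (2 ^ k / 2)) →
        diffQuotient (finrank ℝ E + p) p v z = 0 := by
    intro k m
    have h0 := lintegral_annulus_diffQuotient_eq_zero μ hp hv hvC hweak m
      (r := 2 ^ k) (by positivity)
    rw [← lintegral_prod_symm' _ hm, Measure.prod_restrict, lintegral_eq_zero_iff hm] at h0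
    exact (ae_restrict_iff' (measurableSet_ball.prod
      (measurableSet_ball.diff measurableSet_ball))).1 h0
  have hall : ∀ᵐ z ∂(μ.prod μ), z.2 ≠ 0 → v (z.1 + z.2) = v z.1 := by
    filter_upwards [ae_all_iff.2 fun k => ae_all_iff.2 (hloc k)] with z hz hz2
    have hpos : 0 < ‖z.2‖ := norm_pos_iff.2 hz2
    obtain ⟨k, hk1, hk2⟩ := exists_mem_Ico_zpow hpos (one_lt_two (α := ℝ))
    obtain ⟨m, hm⟩ := exists_nat_gt ‖z.1‖
    have h := hz (k + 1) m ⟨by simpa using hm, by simpa using hk2, by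
      rw [zpow_add_one₀ two_ne_zero]; simpa using hk1⟩
    rw [diffQuotient, ENNReal.ofReal_eq_zero] at h
    by_contra hne
    have : 0 < |v (z.1 + z.2) - v z.1| := abs_pos.2 (sub_ne_zero.2 hne)
    exact absurd h (not_le.2 (by positivity))
  -- By Fubini, fix one good base point x; translation invariance turns almost every h into almost
  -- every x + h.
  obtain ⟨x, hx⟩ := (Measure.ae_ae_of_ae_prod hall).exists
  refine ⟨v x, (eventually_add_left_iff μ x).1 ?_⟩
  filter_upwards [hx, Measure.ae_ne μ 0] with h h1 h2 using h1 h2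

theorem abs_arctan_sub_arctan_le (a b : ℝ) : |Real.arctan a - Real.arctan b| ≤ |a - b| := by
  have h : LipschitzWith 1 Real.arctan := by
    refine lipschitzWith_of_nnnorm_deriv_le Real.differentiable_arctan fun x => ?_
    rw [← NNReal.coe_le_coe, coe_nnnorm, Real.deriv_arctan, Real.norm_of_nonneg (by positivity)]
    exact div_le_one_of_le₀ (by nlinarith [sq_nonneg x]) (by positivity)
  simpa [Real.dist_eq] using h.dist_le_mul a b

theorem abs_arctan_sub_arctan_le_pi (a b : ℝ) : |Real.arctan a - Real.arctan b| ≤ Real.pi := by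
  have := Real.neg_pi_div_two_lt_arctan a
  have := Real.neg_pi_div_two_lt_arctan b
  have := Real.arctan_lt_pi_div_two a
  have := Real.arctan_lt_pi_div_two b
  rw [abs_le]
  constructor <;> linarith

theorem exists_ae_eq_const_of_tendsto_weak [Nontrivial E] {p : ℝ} (hp : 1 ≤ p)
    {u : E → ℝ} (hu : AEMeasurable u μ)
    (hlim : Tendsto (fun t : ℝ => ENNReal.ofReal (t ^ p) * (μ.prod μ) {z : E × E |
      t ≤ |u z.1 - u z.2| / ‖z.1 - z.2‖ ^ ((finrank ℝ E : ℝ) / p + 1)}) atTop (𝓝 0)) :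
    ∃ c, ∀ᵐ x ∂μ, u x = c := by
  have hp0 : 0 < p := by linarith
  obtain ⟨w, hw, huw⟩ := hu
  suffices h : ∃ c, ∀ᵐ x ∂μ, Real.arctan (w x) = c by
    obtain ⟨c, hc⟩ := h
    refine ⟨Real.tan c, ?_⟩
    filter_upwards [hc, huw] with x hx hxu
    rw [hxu, ← hx, Real.tan_arctan]
  refine exists_ae_eq_const_of_weak_diffQuotient μ hp (v := fun x => Real.arctan (w x))
    (by fun_prop) (fun x y => abs_arctan_sub_arctan_le_pi _ _) fun δ hδ => ?_
  have hev := (ENNReal.tendsto_nhds_zero.1 hlim) δ (pos_iff_ne_zero.2 hδ)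
  obtain ⟨t₀, ht₀⟩ := eventually_atTop.1 hev
  refine ⟨ENNReal.ofReal (max t₀ 1 ^ p), by finiteness, fun t ht htop => ?_⟩
  have ht1 : max t₀ 1 ^ p ≤ t.toReal := (ENNReal.ofReal_le_iff_le_toReal htop).1 ht
  have h01 : 0 < max t₀ 1 := lt_max_of_lt_right one_pos
  have htpos : 0 < t.toReal := (by positivity : 0 < max t₀ 1 ^ p).trans_le ht1
  -- Level t for the p-th power is level t^(1/p) for the original quotient, as (N/p + 1)p = N + p.
  have hroot : max t₀ 1 ≤ t.toReal ^ p⁻¹ := (Real.le_rpow_inv_iff_of_pos h01.le htpos.le hp0).2 ht1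
  have hpow : (t.toReal ^ p⁻¹) ^ p = t.toReal := Real.rpow_inv_rpow htpos.le hp0.ne'
  have key := ht₀ _ ((le_max_left _ _).trans hroot)
  rw [hpow, ENNReal.ofReal_toReal htop] at key
  refine (mul_le_mul_right ?_ t).trans key
  -- The shear (x,h) ↦ (x,x+h) passes between increments and pairs of points.
  have hshear : MeasurePreserving (fun z : E × E => (z.1, z.1 + z.2)) (μ.prod μ) (μ.prod μ) :=
    measurePreserving_prod_add μ μ
  set G : Set (E × E) :=
    {z | t.toReal ^ p⁻¹ ≤ |w z.1 - w z.2| / ‖z.1 - z.2‖ ^ ((finrank ℝ E : ℝ) / p + 1)}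
  have hG : MeasurableSet G := measurableSet_le measurable_const (by fun_prop)
  calc (μ.prod μ) {z | t ≤ diffQuotient (finrank ℝ E + p) p (fun x => Real.arctan (w x)) z}
      ≤ (μ.prod μ) ((fun z : E × E => (z.1, z.1 + z.2)) ⁻¹' G) := by
        refine measure_mono fun z hz => ?_
        have hz1 : t.toReal ≤ |Real.arctan (w (z.1 + z.2)) - Real.arctan (w z.1)| ^ p /
            ‖z.2‖ ^ ((finrank ℝ E : ℝ) + p) := by
          refine ENNReal.toReal_le_of_le_ofReal (by positivity) hz
        change t.toReal ^ p⁻¹ ≤ |w z.1 - w (z.1 + z.2)| /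
          ‖z.1 - (z.1 + z.2)‖ ^ ((finrank ℝ E : ℝ) / p + 1)
        rw [sub_add_cancel_left, norm_neg, abs_sub_comm,
          Real.rpow_inv_le_iff_of_pos htpos.le (by positivity) hp0,
          Real.div_rpow (abs_nonneg _) (by positivity), ← Real.rpow_mul (norm_nonneg _), add_mul,
          one_mul, div_mul_cancel₀ _ hp0.ne']
        refine hz1.trans ?_
        exact div_le_div_of_nonneg_right (Real.rpow_le_rpow (abs_nonneg _)
          (abs_arctan_sub_arctan_le _ _) hp0.le) (by positivity)
    _ = (μ.prod μ) G := hshear.measure_preimage hG.nullMeasurableSet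
    _ = _ := by
        refine measure_congr ?_
        filter_upwards [Measure.quasiMeasurePreserving_fst.ae_eq_comp huw,
          Measure.quasiMeasurePreserving_snd.ae_eq_comp huw] with z h1 h2
        simp only [Function.comp_apply] at h1 h2
        refine propext ?_
        change t.toReal ^ p⁻¹ ≤ |w z.1 - w z.2| / _ ↔ t.toReal ^ p⁻¹ ≤ |u z.1 - u z.2| / _
        rw [h1, h2]

end Constancy

/-- Lebesgue measurability of `u` is `AEMeasurable u volume`; `volume` on the product is `2N`-dimensional
Lebesgue measure; the limit is taken in `[0, ∞]`, so that infinite level sets are not lost. -/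
theorem theorem2 (N : ℕ) (p : ℝ) (hp : 1 ≤ p)
    (u : EuclideanSpace ℝ (Fin N) → ℝ) (hu : AEMeasurable u volume)
    (hlim : Tendsto
      (fun t : ℝ =>
        ENNReal.ofReal (t ^ p) *
          volume {z : EuclideanSpace ℝ (Fin N) × EuclideanSpace ℝ (Fin N) |
            t ≤ |u z.1 - u z.2| / ‖z.1 - z.2‖ ^ ((N : ℝ) / p + 1)})
      atTop (𝓝 0)) :
    ∃ c : ℝ, ∀ᵐ x ∂(volume : Measure (EuclideanSpace ℝ (Fin N))), u x = c := by
  -- For N = 0 the space is a point; otherwise points are null, so h = 0 can be discarded.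
  rcases subsingleton_or_nontrivial (EuclideanSpace ℝ (Fin N)) with h | h
  · exact ⟨u 0, Eventually.of_forall fun x => by rw [Subsingleton.elim x 0]⟩
  · refine exists_ae_eq_const_of_tendsto_weak volume hp hu ?_
    rw [finrank_euclideanSpace_fin]
    exact hlim
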